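/- All graphs are finite and simple. Let $T$ be a tree with vertices $1,\dots,k$, and let $H$ be a blow-up of $T$: for non-empty pairwise disjoint sets $V_1,\dots,V_k$, the graph $H$ has vertex set $V_1\cup\dots\cup V_k$, and $x\in V_i$, $y\in V_j$ are adjacent in $H$ if and only if $i$ and $j$ are adjacent in $T$. Let $G$ be an $H$-tree, i.e. a graph obtained from $H$ by taking a tree $T_x$ for each vertex $x$ of $H$ (these trees being pairwise disjoint) and identifying $x$ with exactly one vertex of $T_x$; thus $V(H)\subseteq V(G)$. Assume that $G$ is connected (this is automatic for $k\ge 2$), and let $w:V(G)\to[0,\infty)$ be a weight function. In the game on $G$, two players alternately claim vertices, each claimed vertex being removed from the graph, until all vertices are claimed; a vertex $v$ of the remaining graph $G'$ may be claimed if and only if $G'-v$ is not disconnected. In the game on $G$ rooted at $S$, where $S\subseteq V(G)$ meets every component of $G$, a vertex $v$ of the remaining graph $G'$ may be claimed if and only if every component of $G'-v$ contains a vertex of $S$. The score of a player is the total weight of the vertices this player claims, and each player aims to maximize it. Player $-1$ is the player who makes the last move and Player $-2$ is the other player. For $j\in\{-1,-2\}$, let $N(G,j)$ and $R(G,S,j)$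 denote the score of Player $j$ in the game on $G$ and in the game on $G$ rooted at $S$, respectively, when both players play optimally. For $A\subseteq V(H)$, let $N_H(A)$ be the set of vertices of $H$ having a neighbour (in $H$) in $A$. Then $$R(G,S,-2)\le N(G,-2)\qquad\text{and, equivalently,}\qquad N(G,-1)\le R(G,S,-1)$$ in each of the following cases: 1. $S=\{v\}$ for any vertex $v\in V(G)$; 2. $S=V_i$ for any $i\in\{1,\dots,k\}$; 3. $S=N_H(V_i)$ for any $i\in\{1,\dots,k\}$ with $N_H(V_i)\neq\emptyset$ (which always holds if $k\ge 2$). -/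

import Mathlib

namespace GraphGrabbing

section Graphs

variable {V W ι : Type*}

/-- The neighbourhood `N_G(S)`: the vertices having a neighbour in `S`. -/
def nbhd (G : SimpleGraph V) (S : Set V) : Set V :=
  {y | ∃ x ∈ S, G.Adj x y}

/-- `S` is a root set of `G`: it intersects every connected component of `G`. -/
def IsRootSet (G : SimpleGraph V) (S : Set V) : Prop :=
  ∀ c : G.ConnectedComponent, ∃ s ∈ S, s ∈ c.supp

/-- `H` is a blow-up of `T`: each vertex `i` of `T` is replaced by the non-empty set
`V_i = {x | part x = i}`, and `x ∈ V_i`, `y ∈ V_j` are adjacent in `H` if and only if `i`, `j` are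
adjacent in `T`. -/
structure IsBlowUp (T : SimpleGraph ι) (H : SimpleGraph W) (part : W → ι) : Prop where
  nonempty : ∀ i, ∃ x, part x = i
  adj_iff : ∀ x y, H.Adj x y ↔ T.Adj (part x) (part y)

/-- `G` is an `H`-tree: it is obtained from `H` and trees `T_x`, one for each vertex `x` of `H`, by
identifying the vertex `x` of `H` with exactly one vertex of `T_x`. Here `base v` is the
vertex `x` of `H` such that `v` is a vertex of `T_x`, so `T_x` is the subgraph of `G` induced on the
fibre of `base` over `x`, and `incl x` is the vertex of `G` that results from identifying `x` with a
vertex of `T_x`. The edges of `G` between different trees are exactly the edges of `H`. -/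
structure IsGraphTree (H : SimpleGraph W) (G : SimpleGraph V) (incl : W → V) (base : V → W) :
    Prop where
  base_incl : ∀ x, base (incl x) = x
  isTree : ∀ x, (G.induce {v | base v = x}).IsTree
  adj_iff : ∀ u v, base u ≠ base v →
    (G.Adj u v ↔ H.Adj (base u) (base v) ∧ u = incl (base u) ∧ v = incl (base v))

end Graphs

section Game

open scoped Classical

variable {V : Type*}

/-- The feasible moves of the game on `G` when `A` is the set of the remaining vertices: those `v` for
which the remaining graph minus `v` is not disconnected. (After the last vertex has been claimed the
remaining graph is empty, which counts as feasible.) -/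
noncomputable def moves (G : SimpleGraph V) (A : Finset V) : Finset V :=
  A.filter fun v => (G.induce {u | u ∈ A.erase v}).Preconnected

/-- The feasible moves of the game on `G` rooted at `S` when `A` is the set of the remaining vertices:
those `v` for which every component of the remaining graph minus `v` contains a vertex of `S`. -/
noncomputable def rootedMoves (G : SimpleGraph V) (S : Set V) (A : Finset V) : Finset V :=
  A.filter fun v => IsRootSet (G.induce {u | u ∈ A.erase v}) {u | (u : V) ∈ S}

/-- Backward induction for a game in which two players alternately claim a vertex from the finite set
`mv A` of feasible moves, `A` being the set of the remaining vertices, and in which at most `n` moves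
are still to be made. The first component is the total weight that the player to move collects from
now on, the second one the total weight that the other player collects from now on, when both
play optimally: the player to move maximizes their own total, equivalently (all vertices get
claimed, so the sum of the two totals is constant) minimizes the total of the opponent. -/
noncomputable def optimalScores (mv : Finset V → Finset V) (w : V → ℝ) : ℕ → Finset V → ℝ × ℝ
  | 0, _ => (0, 0)
  | n + 1, A =>
    if h : (mv A).Nonempty then
      ((mv A).sup' h fun v => w v + (optimalScores mv w n (A.erase v)).2,
        (mv A).inf' h fun v => (optimalScores mv w n (A.erase v)).1)
    else (0, 0)

/-- Player `1` (first to move), Player `2`, Player `-1` (making the last move) and Player `-2`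
(the one of the two players who does not make the last move). -/
inductive Player
  | first
  | second
  | last
  | secondLast

/-- The score of a player out of the scores `p` of the first and the second player in a game of
`n` moves: the last move is made by the first player if and only if `n` is odd. -/
noncomputable def Player.score (n : ℕ) (p : ℝ × ℝ) : Player → ℝ
  | .first => p.1
  | .second => p.2
  | .last => if Odd n then p.1 else p.2
  | .secondLast => if Odd n then p.2 else p.1

variable [Fintype V]

/-- `N(G, k)`: the score of Player `k` in the game on `G` with weights `w`. -/
noncomputable def N (G : SimpleGraph V) (w : V → ℝ) (k : Player) : ℝ :=
  k.score (Fintype.card V) (optimalScores (moves G) w (Fintype.card V) Finset.univ)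

/-- `R(G, S, k)`: the score of Player `k` in the game on `G` rooted at `S` with weights `w`. -/
noncomputable def R (G : SimpleGraph V) (w : V → ℝ) (S : Set V) (k : Player) : ℝ :=
  k.score (Fintype.card V) (optimalScores (rootedMoves G S) w (Fintype.card V) Finset.univ)

end Game

end GraphGrabbing

/-! Let the gap of a position be the total of the player to move minus that of the opponent. Since
all weight is distributed, the claim says that rooting does not raise the gap on an even number of
vertices and does not lower it on an odd number. `IsRootFamily.gap_le` shows this for every
connected vertex set `A` and every root set of the family meeting `A`, by induction on the size of
`A` and then on the number of roots in `A`. Fixing `G` and varying `A` avoids describing which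
subgraphs arise during play.

An optimal move of the game whose gap should be smaller is copied in the other game. This fails if a
rooted move `x` disconnects `A`, or if an unrooted move takes the only root. Two facts help. A
single root `x` is claimed last, so up to the weight of `x` that game is the one on `A - x` rooted
at the neighbours of `x` (`gap_rooted_singleton`). And if `A` is even and arises by completely
joining root sets `S₁` and `S₂` of two parts, the gaps for `S₁` and `S₂` have non-negative sum
(`IsJoin.gap_add_nonneg`): both are the same sum of two games, differing only in which summand must
end last.

At a cut vertex `x` the roots in `A - x` are exactly the neighbours of `x`
(`IsLayout.trace_of_cut`). Hence the gap for `S` is minus that for `{x}`, so at most the gap for a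
root set joined to `{x}`, which has fewer vertices in `A` (`IsLayout.join_of_cut`). The second
failure is treated similarly with `IsLayout.trace_of_conn` and `IsLayout.exists_join`. -/

namespace GraphGrabbing

/-! ### Abstract claiming games: the gap recursion and sums of two games -/

section Gap

open scoped Classical

variable {V : Type*}

/-- The feasible moves in the game whose admissible positions are given by `P`. -/
noncomputable def movesOf (P : Finset V → Prop) (A : Finset V) : Finset V :=
  A.filter fun v => P (A.erase v)

/-- Every non-empty admissible position allows a move. -/
def Accessible (P : Finset V → Prop) : Prop :=
  ∀ A : Finset V, A.Nonempty → P A → ∃ v ∈ A, P (A.erase v)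

/-- The score of the player to move minus the score of the other player. -/
noncomputable def gap (P : Finset V → Prop) (w : V → ℝ) (A : Finset V) : ℝ :=
  (optimalScores (movesOf P) w A.card A).1 - (optimalScores (movesOf P) w A.card A).2

variable {P P₁ P₂ Q : Finset V → Prop} {w : V → ℝ} {A : Finset V}

theorem mem_movesOf {v : V} : v ∈ movesOf P A ↔ v ∈ A ∧ P (A.erase v) := by
  simp [movesOf]

theorem Accessible.movesOf_nonempty (hP : Accessible P) (hA : A.Nonempty) (hPA : P A) :
    (movesOf P A).Nonempty := by
  obtain ⟨v, hv, h⟩ := hP A hA hPA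
  exact ⟨v, mem_movesOf.2 ⟨hv, h⟩⟩

theorem optimalScores_succ {mv : Finset V → Finset V} (n : ℕ) (h : (mv A).Nonempty) :
    optimalScores mv w (n + 1) A =
      ((mv A).sup' h fun v => w v + (optimalScores mv w n (A.erase v)).2,
        (mv A).inf' h fun v => (optimalScores mv w n (A.erase v)).1) := by
  simp [optimalScores, h]

theorem optimalScores_add (hP : Accessible P) (n : ℕ) : ∀ A : Finset V, A.card = n → P A →
    (optimalScores (movesOf P) w n A).1 + (optimalScores (movesOf P) w n A).2 = ∑ v ∈ A, w v := by
  induction n with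
  | zero =>
    intro A hA _
    rw [Finset.card_eq_zero] at hA
    simp [optimalScores, hA]
  | succ n ih =>
    intro A hA hPA
    have hne := hP.movesOf_nonempty (Finset.card_pos.1 (by omega)) hPA
    rw [optimalScores_succ n hne]
    have key : ∀ v ∈ movesOf P A, (optimalScores (movesOf P) w n (A.erase v)).1 +
        (w v + (optimalScores (movesOf P) w n (A.erase v)).2) = ∑ v ∈ A, w v := by
      intro v hv
      obtain ⟨hvA, hv'⟩ := mem_movesOf.1 hv
      have := ih (A.erase v) (by rw [Finset.card_erase_of_mem hvA]; omega) hv'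
      rw [← Finset.add_sum_erase A w hvA, ← this]
      ring
    apply le_antisymm
    · obtain ⟨v, hv, h⟩ := Finset.exists_mem_eq_sup' hne
        fun v => w v + (optimalScores (movesOf P) w n (A.erase v)).2
      have h2 := Finset.inf'_le (fun v => (optimalScores (movesOf P) w n (A.erase v)).1) hv
      have := key v hv
      simp only at h h2 ⊢
      linarith
    · obtain ⟨v, hv, h⟩ := Finset.exists_mem_eq_inf' hne
        fun v => (optimalScores (movesOf P) w n (A.erase v)).1
      have h2 := Finset.le_sup' (fun v => w v + (optimalScores (movesOf P) w n (A.erase v)).2) hv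
      have := key v hv
      simp only at h h2 ⊢
      linarith

theorem sub_gap_erase (hP : Accessible P) {v : V} (hv : v ∈ A) (hPv : P (A.erase v)) :
    w v - gap P w (A.erase v) =
      ∑ v ∈ A, w v - 2 * (optimalScores (movesOf P) w (A.card - 1) (A.erase v)).1 := by
  have := optimalScores_add (w := w) hP _ (A.erase v) rfl hPv
  have h2 := Finset.add_sum_erase A w hv
  rw [Finset.card_erase_of_mem hv] at this
  rw [gap, Finset.card_erase_of_mem hv]
  linarith

theorem gap_eq_sum_sub (hP : Accessible P) (hA : A.Nonempty) (hPA : P A) :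
    gap P w A = ∑ v ∈ A, w v - 2 * (movesOf P A).inf' (hP.movesOf_nonempty hA hPA)
      fun v => (optimalScores (movesOf P) w (A.card - 1) (A.erase v)).1 := by
  have h := optimalScores_add (w := w) hP _ A rfl hPA
  obtain ⟨n, hn⟩ : ∃ n, A.card = n + 1 := ⟨A.card - 1, by have := Finset.card_pos.2 hA; omega⟩
  rw [gap]
  rw [hn, optimalScores_succ n (hP.movesOf_nonempty hA hPA)] at h ⊢
  simp only [Nat.add_sub_cancel] at h ⊢
  linarith

/-- With `exists_gap_eq`, this replaces the pair of scores by a single recursion: the gap is the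
maximum of `w v` minus the next gap. -/
theorem sub_gap_erase_le_gap (hP : Accessible P) (hPA : P A) {v : V} (hv : v ∈ A)
    (hPv : P (A.erase v)) : w v - gap P w (A.erase v) ≤ gap P w A := by
  rw [sub_gap_erase hP hv hPv, gap_eq_sum_sub hP ⟨v, hv⟩ hPA]
  have := Finset.inf'_le (fun v => (optimalScores (movesOf P) w (A.card - 1) (A.erase v)).1)
    (mem_movesOf.2 ⟨hv, hPv⟩)
  linarith

theorem exists_gap_eq (hP : Accessible P) (hA : A.Nonempty) (hPA : P A) :
    ∃ v ∈ A, P (A.erase v) ∧ gap P w A = w v - gap P w (A.erase v) := by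
  obtain ⟨v, hv, h⟩ := Finset.exists_mem_eq_inf' (hP.movesOf_nonempty hA hPA)
    fun v => (optimalScores (movesOf P) w (A.card - 1) (A.erase v)).1
  obtain ⟨hv, hPv⟩ := mem_movesOf.1 hv
  exact ⟨v, hv, hPv, by rw [sub_gap_erase hP hv hPv, gap_eq_sum_sub hP hA hPA, h]⟩

@[simp]
theorem gap_empty : gap P w ∅ = 0 := by
  simp [gap, optimalScores]

theorem gap_congr (hP : Accessible P) (hQ : Accessible Q) (hPA : P A)
    (h : ∀ B ⊆ A, P B ↔ Q B) : gap P w A = gap Q w A := by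
  induction A using Finset.strongInduction with
  | H A ih =>
    rcases A.eq_empty_or_nonempty with rfl | hA
    · simp
    have key : ∀ v ∈ A, P (A.erase v) → gap P w (A.erase v) = gap Q w (A.erase v) :=
      fun v hv hPv => ih _ (Finset.erase_ssubset hv) hPv
        fun B hB => h B (hB.trans (Finset.erase_subset _ _))
    have hQA := (h A subset_rfl).1 hPA
    apply le_antisymm
    · obtain ⟨v, hv, hPv, he⟩ := exists_gap_eq (w := w) hP hA hPA
      rw [he, key v hv hPv]
      exact sub_gap_erase_le_gap hQ hQA hv ((h _ (Finset.erase_subset _ _)).1 hPv)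
    · obtain ⟨v, hv, hQv, he⟩ := exists_gap_eq (w := w) hQ hA hQA
      have hPv := (h _ (Finset.erase_subset _ _)).2 hQv
      rw [he, ← key v hv hPv]
      exact sub_gap_erase_le_gap hP hPA hv hPv

/-- A vertex that has to be claimed last goes to the player determined by parity. -/
theorem gap_insert_last (hP : Accessible P) (hQ : Accessible Q) {x : V} {B : Finset V}
    (hx : x ∉ B) (h : ∀ C ⊆ B, Q (insert x C) ↔ P C) (h0 : ∀ C ⊆ B, C.Nonempty → ¬ Q C)
    (hPB : P B) :
    gap Q w (insert x B) = gap P w B + (-1) ^ B.card * w x := by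
  induction B using Finset.strongInduction with
  | H B ih =>
    have hQB := (h B subset_rfl).2 hPB
    rcases B.eq_empty_or_nonempty with rfl | hB
    · obtain ⟨v, hv, -, he⟩ := exists_gap_eq (w := w) hQ (by simp) hQB
      obtain rfl : v = x := by simpa using hv
      rw [he]
      simp
    have her : ∀ v ∈ B, (insert x B).erase v = insert x (B.erase v) := by
      intro v hv
      rw [Finset.erase_insert_of_ne]
      rintro rfl
      exact hx hv
    have key : ∀ v ∈ B, P (B.erase v) →
        w v - gap Q w (insert x (B.erase v)) =
          w v - gap P w (B.erase v) + (-1) ^ B.card * w x := by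
      intro v hv hPv
      have hsub := Finset.erase_subset v B
      rw [ih _ (Finset.erase_ssubset hv) (fun hx' => hx (hsub hx'))
        (fun C hC => h C (hC.trans hsub)) (fun C hC => h0 C (hC.trans hsub)) hPv,
        ← Finset.card_erase_add_one hv, pow_succ]
      ring
    apply le_antisymm
    · obtain ⟨v, hv, hQv, he⟩ := exists_gap_eq (w := w) hQ (by simp) hQB
      have hvB : v ∈ B := by
        rcases Finset.mem_insert.1 hv with rfl | hv
        · rw [Finset.erase_insert hx] at hQv
          exact absurd hQv (h0 B subset_rfl hB)
        · exact hv
      rw [her v hvB] at he hQv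
      have hPv := (h _ (Finset.erase_subset _ _)).1 hQv
      rw [he, key v hvB hPv]
      linarith [sub_gap_erase_le_gap (w := w) hP hPB hvB hPv]
    · obtain ⟨v, hv, hPv, he⟩ := exists_gap_eq (w := w) hP hB hPB
      rw [he, ← key v hv hPv, ← her v hv]
      apply sub_gap_erase_le_gap hQ hQB (Finset.mem_insert_of_mem hv)
      rw [her v hv]
      exact (h _ (Finset.erase_subset _ _)).2 hPv

/-- Local replies in the sum of two games in which the last move has to be made in the first one. -/
theorem gap_union_bounds (hP₁ : Accessible P₁) (hP₂ : Accessible P₂) (hQ : Accessible Q)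
    {A₁ A₂ : Finset V} (hA : Disjoint A₁ A₂)
    (h : ∀ B₁ ⊆ A₁, ∀ B₂ ⊆ A₂, Q (B₁ ∪ B₂) ↔ P₁ B₁ ∧ P₂ B₂ ∧ (B₂.Nonempty → B₁.Nonempty))
    (n : ℕ) : ∀ B₁ ⊆ A₁, ∀ B₂ ⊆ A₂, B₁.card + B₂.card = n → Q (B₁ ∪ B₂) →
      (Odd B₁.card → Even B₂.card → gap Q w (B₁ ∪ B₂) ≤ gap P₁ w B₁ + gap P₂ w B₂) ∧
      (Even B₁.card → Even B₂.card → gap P₁ w B₁ - gap P₂ w B₂ ≤ gap Q w (B₁ ∪ B₂)) ∧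
      (Odd B₁.card → Odd B₂.card → gap P₂ w B₂ - gap P₁ w B₁ ≤ gap Q w (B₁ ∪ B₂)) := by
  induction n with
  | zero =>
    intro B₁ _ B₂ _ hn _
    obtain rfl : B₁ = ∅ := Finset.card_eq_zero.1 (by omega)
    obtain rfl : B₂ = ∅ := Finset.card_eq_zero.1 (by omega)
    simp
  | succ n ih =>
    intro B₁ hB₁ B₂ hB₂ hn hQB
    obtain ⟨hP₁B, hP₂B, hne⟩ := (h B₁ hB₁ B₂ hB₂).1 hQB
    have hd : Disjoint B₁ B₂ := Finset.disjoint_of_subset_left hB₁ (Finset.disjoint_of_subset_right hB₂ hA)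
    have e₁ : ∀ v ∈ B₁, (B₁ ∪ B₂).erase v = B₁.erase v ∪ B₂ := by
      intro v hv
      rw [Finset.erase_union_distrib, Finset.erase_eq_of_notMem (Finset.disjoint_left.1 hd hv)]
    have e₂ : ∀ v ∈ B₂, (B₁ ∪ B₂).erase v = B₁ ∪ B₂.erase v := by
      intro v hv
      rw [Finset.erase_union_distrib, Finset.erase_eq_of_notMem (Finset.disjoint_right.1 hd hv)]
    have c₁ : ∀ v ∈ B₁, (B₁.erase v).card + 1 = B₁.card := fun v hv => Finset.card_erase_add_one hv
    have c₂ : ∀ v ∈ B₂, (B₂.erase v).card + 1 = B₂.card := fun v hv => Finset.card_erase_add_one hv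
    have ih₁ : ∀ v ∈ B₁, Q (B₁.erase v ∪ B₂) → _ := fun v hv hq =>
      ih (B₁.erase v) ((Finset.erase_subset _ _).trans hB₁) B₂ hB₂ (by have := c₁ v hv; omega) hq
    have ih₂ : ∀ v ∈ B₂, Q (B₁ ∪ B₂.erase v) → _ := fun v hv hq =>
      ih B₁ hB₁ (B₂.erase v) ((Finset.erase_subset _ _).trans hB₂) (by have := c₂ v hv; omega) hq
    -- The player who does not move last always leaves `B₁` odd and `B₂` even, by replying in the
    -- summand just played in. So `B₁` is non-empty after each of these replies and the constraint
    -- never blocks them; even `B₁` with odd `B₂` does not occur.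
    refine ⟨fun ho he => ?_, fun he₁ he₂ => ?_, fun ho₁ ho₂ => ?_⟩
    · obtain ⟨v, hv, hQv, hg⟩ := exists_gap_eq (w := w) hQ
        ((Finset.card_pos.1 ho.pos).mono Finset.subset_union_left) hQB
      rcases Finset.mem_union.1 hv with hv | hv
      · rw [e₁ v hv] at hQv hg
        have hPv := ((h _ ((Finset.erase_subset _ _).trans hB₁) B₂ hB₂).1 hQv).1
        have h1 := (ih₁ v hv hQv).2.1 (by have := c₁ v hv; grind) he
        have h2 := sub_gap_erase_le_gap (w := w) hP₁ hP₁B hv hPv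
        linarith
      · rw [e₂ v hv] at hQv hg
        have hPv := ((h _ hB₁ _ ((Finset.erase_subset _ _).trans hB₂)).1 hQv).2.1
        have h1 := (ih₂ v hv hQv).2.2 ho (by have := c₂ v hv; grind)
        have h2 := sub_gap_erase_le_gap (w := w) hP₂ hP₂B hv hPv
        linarith
    · have hB₁ne : B₁.Nonempty := by
        rcases B₂.eq_empty_or_nonempty with h0 | h0
        · rw [h0, Finset.card_empty] at hn
          exact Finset.card_pos.1 (by omega)
        · exact hne h0
      obtain ⟨v, hv, hPv, hg⟩ := exists_gap_eq (w := w) hP₁ hB₁ne hP₁B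
      have hc := c₁ v hv
      have ho : Odd (B₁.erase v).card := by grind
      have hQv := (h _ ((Finset.erase_subset v B₁).trans hB₁) B₂ hB₂).2
        ⟨hPv, hP₂B, fun _ => Finset.card_pos.1 ho.pos⟩
      have h1 := (ih₁ v hv hQv).1 ho he₂
      rw [← e₁ v hv] at h1 hQv
      have h2 := sub_gap_erase_le_gap (w := w) hQ hQB
        (Finset.mem_union_left _ hv) hQv
      linarith
    · obtain ⟨v, hv, hPv, hg⟩ := exists_gap_eq (w := w) hP₂ (Finset.card_pos.1 ho₂.pos) hP₂B
      have hc := c₂ v hv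
      have hQv := (h _ hB₁ _ ((Finset.erase_subset v B₂).trans hB₂)).2
        ⟨hP₁B, hPv, fun _ => Finset.card_pos.1 ho₁.pos⟩
      have h1 := (ih₂ v hv hQv).1 ho₁ (by grind)
      rw [← e₂ v hv] at h1 hQv
      have h2 := sub_gap_erase_le_gap (w := w) hQ hQB
        (Finset.mem_union_right _ hv) hQv
      linarith

/-- In the sum of two games with an even number of moves, moving first when one of the games has to
end last is at least as good as moving second when the other one has to. -/
theorem gap_union_add_nonneg {Q₁ Q₂ : Finset V → Prop} (hP₁ : Accessible P₁)
    (hP₂ : Accessible P₂) (hQ₁ : Accessible Q₁) (hQ₂ : Accessible Q₂)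
    {A₁ A₂ : Finset V} (hA : Disjoint A₁ A₂)
    (h₁ : ∀ B₁ ⊆ A₁, ∀ B₂ ⊆ A₂, Q₁ (B₁ ∪ B₂) ↔ P₁ B₁ ∧ P₂ B₂ ∧ (B₂.Nonempty → B₁.Nonempty))
    (h₂ : ∀ B₂ ⊆ A₂, ∀ B₁ ⊆ A₁, Q₂ (B₂ ∪ B₁) ↔ P₂ B₂ ∧ P₁ B₁ ∧ (B₁.Nonempty → B₂.Nonempty))
    (he : Even (A₁ ∪ A₂).card) (hQ₁A : Q₁ (A₁ ∪ A₂)) (hQ₂A : Q₂ (A₁ ∪ A₂)) :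
    0 ≤ gap Q₁ w (A₁ ∪ A₂) + gap Q₂ w (A₁ ∪ A₂) := by
  rw [Finset.card_union_of_disjoint hA] at he
  have b₁ := gap_union_bounds (w := w) hP₁ hP₂ hQ₁ hA h₁ _ A₁ subset_rfl A₂ subset_rfl rfl hQ₁A
  rw [Finset.union_comm] at hQ₂A
  have b₂ := gap_union_bounds (w := w) hP₂ hP₁ hQ₂ hA.symm h₂ _ A₂ subset_rfl A₁ subset_rfl rfl hQ₂A
  rw [Finset.union_comm A₂ A₁] at b₂
  -- For either parity the lower bounds for `Q₁` and `Q₂` are negatives of each other.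
  rcases Nat.even_or_odd A₁.card with h | h
  · have h' : Even A₂.card := by grind
    linarith [b₁.2.1 h h', b₂.2.1 h' h]
  · have h' : Odd A₂.card := by grind
    linarith [b₁.2.2 h h', b₂.2.2 h' h]

end Gap

/-! ### Rooted and connected positions, joins, and the main induction -/

section Rooted

open scoped Classical

variable {V : Type*} {G : SimpleGraph V} {w : V → ℝ} {A C : Finset V} {S S₁ S₂ : Set V}

/-- `C` is a union of components of the subgraph of `G` induced on `A`. -/
def ClosedIn (G : SimpleGraph V) (A C : Finset V) : Prop :=
  C ⊆ A ∧ ∀ x ∈ C, ∀ y ∈ A, G.Adj x y → y ∈ C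

/-- Every component of the subgraph of `G` induced on `A` meets `S`. -/
def Rooted (G : SimpleGraph V) (S : Set V) (A : Finset V) : Prop :=
  ∀ C : Finset V, ClosedIn G A C → C.Nonempty → ∃ s ∈ C, s ∈ S

/-- The subgraph of `G` induced on `A` is not disconnected. -/
def Conn (G : SimpleGraph V) (A : Finset V) : Prop :=
  ∀ C : Finset V, ClosedIn G A C → C.Nonempty → C = A

theorem ClosedIn.sdiff (h : ClosedIn G A C) : ClosedIn G A (A \ C) := by
  refine ⟨Finset.sdiff_subset, fun x hx y hy hxy => ?_⟩
  rw [Finset.mem_sdiff] at hx ⊢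
  exact ⟨hy, fun hyC => hx.2 (h.2 y hyC x hx.1 hxy.symm)⟩

theorem Conn.rooted (hA : Conn G A) {s : V} (hs : s ∈ A) (hsS : s ∈ S) : Rooted G S A :=
  fun C hC hne => ⟨s, hA C hC hne ▸ hs, hsS⟩

theorem Rooted.congr (h : ∀ a ∈ A, a ∈ S₁ ↔ a ∈ S₂) : Rooted G S₁ A ↔ Rooted G S₂ A := by
  constructor <;> intro hR C hC hne <;> obtain ⟨s, hs, hsS⟩ := hR C hC hne
  · exact ⟨s, hs, (h s (hC.1 hs)).1 hsS⟩
  · exact ⟨s, hs, (h s (hC.1 hs)).2 hsS⟩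

theorem Rooted.conn {v : V} (h : Rooted G {v} A) : Conn G A := by
  intro C hC hne
  by_contra hCA
  obtain ⟨s, hs, rfl⟩ := h C hC hne
  obtain ⟨t, ht, rfl⟩ := h (A \ C) hC.sdiff
    (Finset.sdiff_nonempty.2 fun hAC => hCA (hC.1.antisymm hAC))
  exact (Finset.mem_sdiff.1 ht).2 hs

/-- A largest rooted proper subset `B` can be enlarged by a vertex that is a root or has a neighbour
in `B`; by maximality that vertex is all that is missing, so it can be claimed. -/
theorem accessible_rooted (G : SimpleGraph V) (S : Set V) : Accessible (Rooted G S) := by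
  intro A hA hR
  obtain ⟨B, hB, hmax⟩ := Finset.exists_max_image (A.powerset.filter fun B => B ≠ A ∧ Rooted G S B)
    Finset.card ⟨∅, by
      simp only [Finset.mem_filter, Finset.mem_powerset, Finset.empty_subset, true_and]
      refine ⟨hA.ne_empty.symm, fun C hC hne => ?_⟩
      exact absurd (Finset.subset_empty.1 hC.1) hne.ne_empty⟩
  simp only [Finset.mem_filter, Finset.mem_powerset, and_imp] at hB hmax
  obtain ⟨hBA, hne, hRB⟩ := hB
  obtain ⟨a, ha, haB, hor⟩ : ∃ a ∈ A, a ∉ B ∧ (a ∈ S ∨ ∃ b ∈ B, G.Adj a b) := by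
    by_contra! hcon
    obtain ⟨s, hs, hsS⟩ := hR (A \ B)
      ⟨Finset.sdiff_subset, fun x hx y hy hxy => by
        rw [Finset.mem_sdiff] at hx ⊢
        exact ⟨hy, fun hyB => (hcon x hx.1 hx.2).2 y hyB hxy⟩⟩
      (Finset.sdiff_nonempty.2 fun hAB => hne (hBA.antisymm hAB))
    rw [Finset.mem_sdiff] at hs
    exact (hcon s hs.1 hs.2).1 hsS
  have hins : Rooted G S (insert a B) := by
    intro C hC hCne
    by_contra! hcon
    have hCB : ClosedIn G B (C.erase a) := by
      refine ⟨fun x hx => ?_, fun x hx y hy hxy => ?_⟩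
      · rw [Finset.mem_erase] at hx
        exact (Finset.mem_insert.1 (hC.1 hx.2)).resolve_left hx.1
      · rw [Finset.mem_erase] at hx ⊢
        exact ⟨fun h => haB (h ▸ hy), hC.2 x hx.2 y (Finset.mem_insert_of_mem hy) hxy⟩
    rcases (C.erase a).eq_empty_or_nonempty with h0 | h0
    · obtain ⟨c, hc⟩ := hCne
      obtain rfl : c = a := by
        by_contra hca
        exact Finset.notMem_empty c (h0 ▸ Finset.mem_erase.2 ⟨hca, hc⟩)
      rcases hor with h | ⟨b, hb, hab⟩
      · exact hcon c hc h
      · exact Finset.notMem_empty b (h0 ▸ Finset.mem_erase.2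
          ⟨hab.ne', hC.2 c hc b (Finset.mem_insert_of_mem hb) hab⟩)
    · obtain ⟨s, hs, hsS⟩ := hRB _ hCB h0
      exact hcon s (Finset.mem_of_mem_erase hs) hsS
  have heq : insert a B = A := by
    by_contra hcon
    have := hmax _ (Finset.insert_subset ha hBA) hcon hins
    rw [Finset.card_insert_of_notMem haB] at this
    omega
  refine ⟨a, ha, ?_⟩
  rwa [← heq, Finset.erase_insert haB]

theorem accessible_conn (G : SimpleGraph V) : Accessible (Conn G) := by
  rintro A ⟨a, ha⟩ hA
  obtain ⟨v, hv, hR⟩ := accessible_rooted G {a} A ⟨a, ha⟩ (hA.rooted ha rfl)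
  exact ⟨v, hv, hR.conn⟩

/-- The subgraph of `G` induced on `A₁ ∪ A₂` arises from those induced on `A₁` and on `A₂` by joining
completely the root sets `S₁` and `S₂`. -/
structure IsJoin (G : SimpleGraph V) (S₁ S₂ : Set V) (A₁ A₂ : Finset V) : Prop where
  disjoint : Disjoint A₁ A₂
  notMem_left : ∀ a ∈ A₂, a ∉ S₁
  notMem_right : ∀ a ∈ A₁, a ∉ S₂
  nonempty_left : ∃ a ∈ A₁, a ∈ S₁
  nonempty_right : ∃ a ∈ A₂, a ∈ S₂
  adj_iff : ∀ a ∈ A₁, ∀ b ∈ A₂, G.Adj a b ↔ a ∈ S₁ ∧ b ∈ S₂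

theorem IsJoin.symm {A₁ A₂ : Finset V} (h : IsJoin G S₁ S₂ A₁ A₂) : IsJoin G S₂ S₁ A₂ A₁ where
  disjoint := h.disjoint.symm
  notMem_left := h.notMem_right
  notMem_right := h.notMem_left
  nonempty_left := h.nonempty_right
  nonempty_right := h.nonempty_left
  adj_iff := fun a ha b hb => by rw [G.adj_comm, h.adj_iff b hb a ha, and_comm]

/-- A component within `B₂` can reach a root only through `S₂`, and any remaining vertex of `S₁`
serves all of `S₂`. So the two sides are played independently, except that the `S₁` side must end
last. -/
theorem IsJoin.rooted_union_iff {A₁ A₂ B₁ B₂ : Finset V} (h : IsJoin G S₁ S₂ A₁ A₂)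
    (h₁ : B₁ ⊆ A₁) (h₂ : B₂ ⊆ A₂) :
    Rooted G S₁ (B₁ ∪ B₂) ↔
      Rooted G S₁ B₁ ∧ Rooted G S₂ B₂ ∧ (B₂.Nonempty → B₁.Nonempty) := by
  constructor
  · intro hR
    refine ⟨fun C hC hne => ?_, fun C hC hne => ?_, fun hne => ?_⟩
    · by_contra! hcon
      obtain ⟨s, hs, hsS⟩ := hR C ⟨hC.1.trans Finset.subset_union_left, fun x hx y hy hxy => by
        rcases Finset.mem_union.1 hy with hy | hy
        · exact hC.2 x hx y hy hxy
        · exact absurd ((h.adj_iff x (h₁ (hC.1 hx)) y (h₂ hy)).1 hxy).1 (hcon x hx)⟩ hne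
      exact hcon s hs hsS
    · by_contra! hcon
      obtain ⟨s, hs, hsS⟩ := hR C ⟨hC.1.trans Finset.subset_union_right, fun x hx y hy hxy => by
        rcases Finset.mem_union.1 hy with hy | hy
        · exact absurd ((h.adj_iff y (h₁ hy) x (h₂ (hC.1 hx))).1 hxy.symm).2 (hcon x hx)
        · exact hC.2 x hx y hy hxy⟩ hne
      exact h.notMem_left s (h₂ (hC.1 hs)) hsS
    · obtain ⟨s, hs, hsS⟩ := hR _ ⟨subset_rfl, fun _ _ _ hy _ => hy⟩
        (hne.mono Finset.subset_union_right)
      rcases Finset.mem_union.1 hs with hs | hs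
      · exact ⟨s, hs⟩
      · exact absurd hsS (h.notMem_left s (h₂ hs))
  · rintro ⟨hR₁, hR₂, himp⟩ C hC hne
    by_contra! hcon
    have hC₁ : C ⊆ B₂ := by
      intro x hx
      by_contra hx₂
      have hx₁ := (Finset.mem_union.1 (hC.1 hx)).resolve_right hx₂
      obtain ⟨s, hs, hsS⟩ := hR₁ (C.filter (· ∈ B₁))
        ⟨fun y hy => (Finset.mem_filter.1 hy).2, fun y hy z hz hyz => Finset.mem_filter.2
          ⟨hC.2 y (Finset.mem_filter.1 hy).1 z (Finset.mem_union_left _ hz) hyz, hz⟩⟩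
        ⟨x, Finset.mem_filter.2 ⟨hx, hx₁⟩⟩
      exact hcon s (Finset.mem_filter.1 hs).1 hsS
    obtain ⟨s, hs, hsS⟩ := hR₂ C
      ⟨hC₁, fun y hy z hz hyz => hC.2 y hy z (Finset.mem_union_right _ hz) hyz⟩ hne
    obtain ⟨t, ht, htS⟩ := hR₁ _ ⟨subset_rfl, fun _ _ _ hy _ => hy⟩ (himp (hne.mono hC₁))
    exact hcon t (hC.2 s hs t (Finset.mem_union_left _ ht)
      ((h.adj_iff t (h₁ ht) s (h₂ (hC₁ hs))).2 ⟨htS, hsS⟩).symm) htS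

theorem IsJoin.gap_add_nonneg {A₁ A₂ : Finset V} (h : IsJoin G S₁ S₂ A₁ A₂)
    (hc : Conn G (A₁ ∪ A₂)) (he : Even (A₁ ∪ A₂).card) :
    0 ≤ gap (Rooted G S₁) w (A₁ ∪ A₂) + gap (Rooted G S₂) w (A₁ ∪ A₂) := by
  obtain ⟨a, ha, haS⟩ := h.nonempty_left
  obtain ⟨b, hb, hbS⟩ := h.nonempty_right
  exact gap_union_add_nonneg (accessible_rooted G S₁) (accessible_rooted G S₂)
    (accessible_rooted G S₁) (accessible_rooted G S₂) h.disjoint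
    (fun B₁ h₁ B₂ h₂ => h.rooted_union_iff h₁ h₂)
    (fun B₂ h₂ B₁ h₁ => h.symm.rooted_union_iff h₂ h₁) he
    (hc.rooted (Finset.mem_union_left _ ha) haS) (hc.rooted (Finset.mem_union_right _ hb) hbS)

theorem gap_rooted_congr (hR : Rooted G S₁ A) (h : ∀ a ∈ A, a ∈ S₁ ↔ a ∈ S₂) :
    gap (Rooted G S₁) w A = gap (Rooted G S₂) w A :=
  gap_congr (accessible_rooted G _) (accessible_rooted G _) hR
    fun _ hB => Rooted.congr fun a ha => h a (hB ha)

theorem rooted_singleton_insert_iff {x : V} (hx : x ∉ C) (h : ∀ a ∈ C, a ∈ S ↔ G.Adj x a) :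
    Rooted G {x} (insert x C) ↔ Rooted G S C := by
  constructor
  · intro hR D hD hne
    by_contra! hcon
    obtain ⟨s, hs, rfl⟩ := hR D ⟨hD.1.trans (Finset.subset_insert _ _), fun y hy z hz hyz => by
      rcases Finset.mem_insert.1 hz with rfl | hz
      · exact absurd ((h y (hD.1 hy)).2 hyz.symm) (hcon y hy)
      · exact hD.2 y hy z hz hyz⟩ hne
    exact hx (hD.1 hs)
  · intro hR D hD hne
    by_contra! hcon
    have hxD : x ∉ D := fun hxD => hcon x hxD rfl
    obtain ⟨s, hs, hsS⟩ := hR D ⟨fun y hy => (Finset.mem_insert.1 (hD.1 hy)).resolve_left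
      (fun e => hxD (e ▸ hy)), fun y hy z hz hyz => hD.2 y hy z (Finset.mem_insert_of_mem hz) hyz⟩
      hne
    have hsC : s ∈ C := (Finset.mem_insert.1 (hD.1 hs)).resolve_left (fun e => hxD (e ▸ hs))
    exact hxD (hD.2 s hs x (Finset.mem_insert_self _ _) ((h s hsC).1 hsS).symm)

theorem rooted_erase_of_conn {x : V} (hA : Conn G A) (hx : x ∈ A)
    (h : ∀ a ∈ A.erase x, a ∈ S ↔ G.Adj x a) : Rooted G S (A.erase x) := by
  rw [← rooted_singleton_insert_iff (Finset.notMem_erase x A) h, Finset.insert_erase hx]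
  exact hA.rooted hx rfl

/-- The root of a game with a single root is claimed last. -/
theorem gap_rooted_singleton {x : V} (hA : Conn G A) (hx : x ∈ A)
    (h : ∀ a ∈ A.erase x, a ∈ S ↔ G.Adj x a) :
    gap (Rooted G {x}) w A =
      gap (Rooted G S) w (A.erase x) + (-1) ^ (A.erase x).card * w x := by
  have := gap_insert_last (w := w) (accessible_rooted G S) (accessible_rooted G {x})
    (Finset.notMem_erase x A)
    (fun C hC => rooted_singleton_insert_iff (fun hxC => Finset.notMem_erase x A (hC hxC))
      fun a ha => h a (hC ha))
    (fun C hC hne hR => by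
      obtain ⟨s, hs, rfl⟩ := hR C ⟨subset_rfl, fun _ _ _ hy _ => hy⟩ hne
      exact Finset.notMem_erase s A (hC hs))
    (rooted_erase_of_conn hA hx h)
  rwa [Finset.insert_erase hx] at this

theorem Conn.exists_adj {x : V} (hA : Conn G A) (hx : x ∈ A) (hne : (A.erase x).Nonempty) :
    ∃ a ∈ A.erase x, G.Adj x a :=
  (rooted_erase_of_conn (S := {a | G.Adj x a}) hA hx fun _ _ => Iff.rfl) _
    ⟨subset_rfl, fun _ _ _ hy _ => hy⟩ hne

/-- The properties of a family of root sets that allow to compare the rooted games with the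
unrooted one on all connected induced subgraphs. -/
structure IsRootFamily (G : SimpleGraph V) (F : Set (Set V)) : Prop where
  singleton_mem : ∀ v, {v} ∈ F
  trace_of_cut : ∀ {A : Finset V} {S : Set V} {x : V}, Conn G A → S ∈ F → x ∈ A →
    ¬ Conn G (A.erase x) → Rooted G S (A.erase x) → ∀ a ∈ A.erase x, a ∈ S ↔ G.Adj x a
  join_of_cut : ∀ {A : Finset V} {x : V}, Conn G A → x ∈ A → ¬ Conn G (A.erase x) →
    ∃ S ∈ F, (∃ A₁ A₂, A₁ ∪ A₂ = A ∧ IsJoin G {x} S A₁ A₂) ∧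
      (A.filter (· ∈ S)).card < (A.filter (G.Adj x ·)).card
  trace_of_conn : ∀ {A : Finset V} {x : V}, Conn G (A.erase x) →
    ∃ S ∈ F, ∀ a ∈ A.erase x, a ∈ S ↔ G.Adj x a
  join : ∀ {A : Finset V} {S : Set V}, Conn G A → S ∈ F →
    (∃ a ∈ A, ∃ b ∈ A, a ∈ S ∧ b ∈ S ∧ a ≠ b) →
    ∃ S₂ ∈ F, ∃ A₁ A₂, A₁ ∪ A₂ = A ∧ IsJoin G S S₂ A₁ A₂

theorem IsRootFamily.gap_le {F : Set (Set V)} (hF : IsRootFamily G F) (n : ℕ) :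
    ∀ (k : ℕ) (A : Finset V) (S : Set V), A.card = n → (A.filter (· ∈ S)).card = k → Conn G A →
      S ∈ F → (∃ a ∈ A, a ∈ S) →
      (Even n → gap (Rooted G S) w A ≤ gap (Conn G) w A) ∧
      (Odd n → gap (Conn G) w A ≤ gap (Rooted G S) w A) := by
  induction n using Nat.strong_induction_on with
  | h n ihn =>
  intro k
  induction k using Nat.strong_induction_on with
  | h k ihk =>
  rintro A S rfl hk hA hS ⟨s, hs, hsS⟩
  have hAne : A.Nonempty := ⟨s, hs⟩
  have hR : Rooted G S A := hA.rooted hs hsS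
  have hcard : ∀ v ∈ A, (A.erase v).card + 1 = A.card := fun v hv => Finset.card_erase_add_one hv
  refine ⟨fun he => ?_, fun ho => ?_⟩
  · obtain ⟨x, hx, hRx, hg⟩ := exists_gap_eq (w := w) (accessible_rooted G S) hAne hR
    have hc := hcard x hx
    have hox : Odd (A.erase x).card := by grind
    by_cases hcx : Conn G (A.erase x)
    · obtain ⟨t, ht, htS⟩ := hRx _ ⟨subset_rfl, fun _ _ _ hy _ => hy⟩ (Finset.card_pos.1 hox.pos)
      have h1 := (ihn _ (by omega) _ (A.erase x) S rfl rfl hcx hS ⟨t, ht, htS⟩).2 hox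
      have h2 := sub_gap_erase_le_gap (w := w) (accessible_conn G) hA hx hcx
      linarith
    -- Here `x` is a cut vertex: the gap for `S` equals minus the gap for `{x}`, so it is at most
    -- the gap for `S₂`, which has fewer vertices in `A`.
    · have htr := hF.trace_of_cut hA hS hx hcx hRx
      obtain ⟨S₂, hS₂, ⟨A₁, A₂, rfl, hj⟩, hlt⟩ := hF.join_of_cut hA hx hcx
      have h1 := gap_rooted_singleton (w := w) hA hx htr
      rw [hox.neg_one_pow] at h1
      have h2 := hj.gap_add_nonneg (w := w) hA he
      obtain ⟨b, hb, hbS⟩ := hj.nonempty_right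
      have hle : ((A₁ ∪ A₂).filter (G.Adj x ·)).card ≤ k := by
        rw [← hk]
        apply Finset.card_le_card
        intro a ha
        rw [Finset.mem_filter] at ha ⊢
        exact ⟨ha.1, (htr a (Finset.mem_erase.2 ⟨ha.2.ne', ha.1⟩)).2 ha.2⟩
      have h3 := (ihk _ (hlt.trans_le hle) _ S₂ rfl rfl hA hS₂
        ⟨b, Finset.mem_union_right _ hb, hbS⟩).1 he
      linarith
  · obtain ⟨x, hx, hcx, hg⟩ := exists_gap_eq (w := w) (accessible_conn G) hAne hA
    have hc := hcard x hx
    have hex : Even (A.erase x).card := by grind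
    by_cases hSx : ∃ a ∈ A.erase x, a ∈ S
    · obtain ⟨a, ha, haS⟩ := hSx
      have h1 := (ihn _ (by omega) _ (A.erase x) S rfl rfl hcx hS ⟨a, ha, haS⟩).1 hex
      have h2 := sub_gap_erase_le_gap (w := w) (accessible_rooted G S) hR hx (hcx.rooted ha haS)
      linarith
    rcases (A.erase x).eq_empty_or_nonempty with h0 | hne
    · have hRx : Rooted G S (A.erase x) := fun C hC hne =>
        absurd (Finset.subset_empty.1 (h0 ▸ hC.1)) hne.ne_empty
      have h2 := sub_gap_erase_le_gap (w := w) (accessible_rooted G S) hR hx hRx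
      rw [h0, gap_empty] at h2 hg
      linarith
    push Not at hSx
    have hsx : s = x := by
      by_contra hsx
      exact hSx s (Finset.mem_erase.2 ⟨hsx, hs⟩) hsS
    subst hsx
    have hgS : gap (Rooted G S) w A = gap (Rooted G {s}) w A := by
      apply gap_rooted_congr hR
      intro a ha
      constructor
      · intro haS
        by_contra has
        exact hSx a (Finset.mem_erase.2 ⟨has, ha⟩) haS
      · rintro rfl
        exact hsS
    obtain ⟨S', hS', htr⟩ := hF.trace_of_conn hcx
    have h1 := gap_rooted_singleton (w := w) hA hs htr
    rw [hex.neg_one_pow] at h1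
    obtain ⟨u, hu, hsu⟩ := hA.exists_adj hs hne
    have huS := (htr u hu).2 hsu
    -- it remains to move first without roots at least as well as second with roots `S'`
    suffices h : 0 ≤ gap (Rooted G S') w (A.erase s) + gap (Conn G) w (A.erase s) by linarith
    have hevn := fun (T : Set V) (hT : T ∈ F) (hTA : ∃ a ∈ A.erase s, a ∈ T) =>
      (ihn _ (by omega) _ (A.erase s) T rfl rfl hcx hT hTA).1 hex
    generalize hA' : A.erase s = A' at *
    -- With two roots, a partner `S₂` of `S'` exists and its game bounds the unrooted one from
    -- below. A lone root `u` is itself claimed first in the unrooted game if this keeps `A'`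
    -- connected; otherwise it is a cut vertex and has a partner.
    by_cases htwo : ∃ a ∈ A', ∃ b ∈ A', a ∈ S' ∧ b ∈ S' ∧ a ≠ b
    · obtain ⟨S₂, hS₂, A₁, A₂, rfl, hj⟩ := hF.join hcx hS' htwo
      obtain ⟨b, hb, hbS⟩ := hj.nonempty_right
      have h2 := hj.gap_add_nonneg (w := w) hcx hex
      have h3 := hevn S₂ hS₂ ⟨b, Finset.mem_union_right _ hb, hbS⟩
      linarith
    push Not at htwo
    have hgS' : gap (Rooted G S') w A' = gap (Rooted G {u}) w A' := by
      apply gap_rooted_congr (hcx.rooted hu huS)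
      intro a ha
      constructor
      · intro haS
        exact htwo a ha u hu haS huS
      · rintro rfl
        exact huS
    rw [hgS']
    by_cases hcu : Conn G (A'.erase u)
    · obtain ⟨S₃, hS₃, htr₃⟩ := hF.trace_of_conn hcu
      have hcard' := Finset.card_erase_add_one hu
      have hou : Odd (A'.erase u).card := by grind
      have h2 := gap_rooted_singleton (w := w) hcx hu htr₃
      rw [hou.neg_one_pow] at h2
      obtain ⟨b, hb, hub⟩ := hcx.exists_adj hu (Finset.card_pos.1 hou.pos)
      have h3 := (ihn _ (by omega) _ (A'.erase u) S₃ rfl rfl hcu hS₃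
        ⟨b, hb, (htr₃ b hb).2 hub⟩).2 hou
      have h4 := sub_gap_erase_le_gap (w := w) (accessible_conn G) hcx hu hcu
      linarith
    · obtain ⟨S₂, hS₂, ⟨A₁, A₂, rfl, hj⟩, -⟩ := hF.join_of_cut hcx hu hcu
      obtain ⟨b, hb, hbS⟩ := hj.nonempty_right
      have h2 := hj.gap_add_nonneg (w := w) hcx hex
      have h3 := hevn S₂ hS₂ ⟨b, Finset.mem_union_right _ hb, hbS⟩
      linarith

end Rooted

/-! ### Sides of tree edges and the root sets of a blow-up with attached trees -/

section Sides

open scoped Classical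

variable {V W ι : Type*} {G : SimpleGraph V} {A C : Finset V} {S : Set V} {x y : V}

theorem mem_of_reachable {E : Set V} (hE : ∀ a ∈ E, ∀ b, G.Adj a b → b ∈ E) {a b : V}
    (h : G.Reachable a b) (ha : a ∈ E) : b ∈ E := by
  obtain ⟨p⟩ := h
  induction p with
  | nil => exact ha
  | cons hadj _ ih => exact ih (hE _ ha _ hadj)

/-- `y x` is the only edge of `G` leaving the set `D`. -/
structure IsSide (G : SimpleGraph V) (D : Set V) (y x : V) : Prop where
  mem : y ∈ D
  notMem : x ∉ D
  eq_of_adj : ∀ a ∈ D, ∀ b, b ∉ D → G.Adj a b → a = y ∧ b = x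

theorem exists_isSide (hG : G.IsAcyclic) (h : G.Adj y x) : ∃ D, IsSide G D y x := by
  refine ⟨{a | (G.deleteEdges {s(y, x)}).Reachable y a}, .refl y, ?_, fun a ha b hb hab => ?_⟩
  · exact SimpleGraph.isBridge_iff.1 (SimpleGraph.isAcyclic_iff_forall_adj_isBridge.1 hG h)
  · by_contra hcon
    refine hb (SimpleGraph.Reachable.trans ha (SimpleGraph.Adj.reachable ?_))
    rw [SimpleGraph.deleteEdges_adj]
    refine ⟨hab, fun he => ?_⟩
    rcases Sym2.eq_iff.1 (Set.mem_singleton_iff.1 he) with ⟨rfl, rfl⟩ | ⟨rfl, rfl⟩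
    · exact hcon ⟨rfl, rfl⟩
    · exact hb (.refl _)

/-- An edge leaving `D ∩ D'` would start at `y` or `y'`, neither of which lies in both sides; a
non-empty intersection would thus be everything, including `x`. -/
theorem IsSide.disjoint (hG : G.Preconnected) {D D' : Set V} {y' : V} (h : IsSide G D y x)
    (h' : IsSide G D' y' x) (hyx : G.Adj y x) (hyx' : G.Adj y' x) (hne : y ≠ y') :
    Disjoint D D' := by
  rw [Set.disjoint_left]
  intro a ha ha'
  have hy : y ∉ D' := fun hy => hne (h'.eq_of_adj y hy x h'.notMem hyx).1
  have hy' : y' ∉ D := fun hy => hne (h.eq_of_adj y' hy x h.notMem hyx').1.symm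
  refine h.notMem (mem_of_reachable (E := D ∩ D') ?_ (hG a x) ⟨ha, ha'⟩).1
  rintro b ⟨hb, hb'⟩ d hbd
  constructor
  · by_contra hd
    exact hy ((h.eq_of_adj b hb d hd hbd).1 ▸ hb')
  · by_contra hd
    exact hy' ((h'.eq_of_adj b hb' d hd hbd).1 ▸ hb)

theorem IsSide.closedIn {D : Set V} (h : IsSide G D y x) :
    ClosedIn G (A.erase x) ((A.erase x).filter (· ∈ D)) := by
  refine ⟨Finset.filter_subset _ _, fun a ha b hb hab => ?_⟩
  rw [Finset.mem_filter] at ha ⊢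
  refine ⟨hb, ?_⟩
  by_contra hbD
  exact (Finset.mem_erase.1 hb).1 (h.eq_of_adj a ha.2 b hbD hab).2

theorem exists_adj_of_closedIn_erase (hA : Conn G A) (hx : x ∈ A)
    (hC : ClosedIn G (A.erase x) C) (hne : C.Nonempty) : ∃ a ∈ C, G.Adj x a :=
  (rooted_erase_of_conn (S := {a | G.Adj x a}) hA hx fun _ _ => Iff.rfl) C hC hne

theorem exists_two_adj_of_cut (hA : Conn G A) (hx : x ∈ A) (hcut : ¬ Conn G (A.erase x)) :
    ∃ a ∈ A, ∃ b ∈ A, G.Adj x a ∧ G.Adj x b ∧ a ≠ b := by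
  simp only [Conn, not_forall] at hcut
  obtain ⟨C, hC, hne, hCA⟩ := hcut
  obtain ⟨a, ha, hxa⟩ := exists_adj_of_closedIn_erase hA hx hC hne
  obtain ⟨b, hb, hxb⟩ := exists_adj_of_closedIn_erase hA hx hC.sdiff
    (Finset.sdiff_nonempty.2 fun h => hCA (hC.1.antisymm h))
  rw [Finset.mem_sdiff] at hb
  exact ⟨a, Finset.mem_of_mem_erase (hC.1 ha), b, Finset.mem_of_mem_erase hb.1, hxa, hxb,
    fun h => hb.2 (h ▸ ha)⟩

/-- A vertex whose neighbours are all adjacent to some other vertex is not a cut vertex. -/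
theorem conn_erase_of_forall_adj {z : V} (hA : Conn G A) (hx : x ∈ A) (hz : z ∈ A.erase x)
    (h : ∀ a ∈ A.erase x, G.Adj x a → G.Adj z a) : Conn G (A.erase x) := by
  have key : ∀ C, ClosedIn G (A.erase x) C → z ∈ C → C = A.erase x := by
    intro C hC hzC
    have hxC : x ∉ C := fun hxC => Finset.notMem_erase x A (hC.1 hxC)
    have : insert x C = A := by
      refine hA _ ⟨Finset.insert_subset hx (hC.1.trans (Finset.erase_subset _ _)),
        fun a ha b hb hab => ?_⟩ ⟨x, Finset.mem_insert_self _ _⟩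
      by_cases hbx : b = x
      · exact hbx ▸ Finset.mem_insert_self _ _
      have hb' := Finset.mem_erase.2 ⟨hbx, hb⟩
      apply Finset.mem_insert_of_mem
      rcases Finset.mem_insert.1 ha with rfl | ha
      · exact hC.2 z hzC b hb' (h b hb' hab)
      · exact hC.2 a ha b hb' hab
    rw [← this, Finset.erase_insert hxC]
  intro C hC hne
  by_cases hzC : z ∈ C
  · exact key C hC hzC
  · obtain ⟨a, ha⟩ := hne
    have := key _ hC.sdiff (Finset.mem_sdiff.2 ⟨hz, hzC⟩)
    exact absurd ha (Finset.mem_sdiff.1 (this ▸ hC.1 ha)).2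

/-- What the proof uses of a graph obtained by attaching trees to the vertices of a blow-up of `T`:
`B` is the vertex set of the blow-up, `c` assigns to a vertex the vertex of `T` it belongs to, and
the fibres of `base` are the attached trees. -/
structure IsLayout (G : SimpleGraph V) (T : SimpleGraph ι) (base : V → W) (c : V → ι)
    (B : Set V) : Prop where
  colour_eq : ∀ u v, base u = base v → c u = c v
  adj_cases : ∀ u v, G.Adj u v → base u = base v ∨ u ∈ B ∧ v ∈ B ∧ T.Adj (c u) (c v)
  adj_of_colour : ∀ u ∈ B, ∀ v ∈ B, T.Adj (c u) (c v) → G.Adj u v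
  eq_of_mem : ∀ u ∈ B, ∀ v ∈ B, base u = base v → u = v
  exists_side : ∀ y x, G.Adj y x → base y = base x → ∃ D, IsSide G D y x ∧
    ((∀ a ∈ D, a ∉ B) ∨ ∃ r ∈ D, r ∈ B ∧ base r = base x)

/-- The vertices of the blow-up with colour `i`. -/
def colourClass (c : V → ι) (B : Set V) (i : ι) : Set V := {v | v ∈ B ∧ c v = i}

/-- The vertices of the blow-up with a colour adjacent to `i`. -/
def colourNbhd (T : SimpleGraph ι) (c : V → ι) (B : Set V) (i : ι) : Set V :=
  {v | v ∈ B ∧ T.Adj i (c v)}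

/-- The root sets of the theorem. -/
def rootFamily (T : SimpleGraph ι) (c : V → ι) (B : Set V) : Set (Set V) :=
  {S | (∃ v, S = {v}) ∨ (∃ i, S = colourClass c B i) ∨ ∃ i, S = colourNbhd T c B i}

variable {T : SimpleGraph ι} {base : V → W} {c : V → ι} {B : Set V}

theorem subset_of_mem_rootFamily (hS : S ∈ rootFamily T c B) (h : ∀ v, S ≠ {v}) : S ⊆ B := by
  rcases hS with ⟨v, rfl⟩ | ⟨i, rfl⟩ | ⟨i, rfl⟩
  · exact absurd rfl (h v)
  · exact fun a ha => ha.1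
  · exact fun a ha => ha.1

namespace IsLayout

theorem adj_iff_of_no_fibre_nbr (hL : IsLayout G T base c B) (hxB : x ∈ B) (hnt : ∀ y ∈ A, G.Adj x y → base y ≠ base x) :
    ∀ a ∈ A, G.Adj x a ↔ a ∈ B ∧ T.Adj (c x) (c a) := by
  refine fun a ha => ⟨fun h => ?_, fun h => hL.adj_of_colour x hxB a h.1 h.2⟩
  rcases hL.adj_cases x a h with h' | h'
  · exact absurd h'.symm (hnt a ha h)
  · exact h'.2

theorem trace_of_conn (hL : IsLayout G T base c B) (hcx : Conn G (A.erase x)) :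
    ∃ S ∈ rootFamily T c B, ∀ a ∈ A.erase x, a ∈ S ↔ G.Adj x a := by
  by_cases hnt : ∀ y ∈ A, G.Adj x y → base y ≠ base x
  · by_cases hxB : x ∈ B
    · refine ⟨colourNbhd T c B (c x), Or.inr (Or.inr ⟨_, rfl⟩), fun a ha => ?_⟩
      rw [hL.adj_iff_of_no_fibre_nbr hxB hnt a (Finset.mem_of_mem_erase ha)]
      rfl
    -- `x` has no neighbour in `A`, and `{x}` has empty trace on `A.erase x`.
    · refine ⟨{x}, Or.inl ⟨x, rfl⟩, fun a ha => ?_⟩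
      rw [Finset.mem_erase] at ha
      refine ⟨fun h => absurd h ha.1, fun h => ?_⟩
      rcases hL.adj_cases x a h with h' | h'
      · exact absurd h'.symm (hnt a ha.2 h)
      · exact absurd h'.1 hxB
  · push Not at hnt
    obtain ⟨y, hy, hxy, hb⟩ := hnt
    obtain ⟨D, hD, -⟩ := hL.exists_side y x hxy.symm hb
    have hall := hcx _ hD.closedIn
      ⟨y, Finset.mem_filter.2 ⟨Finset.mem_erase.2 ⟨hxy.ne', hy⟩, hD.mem⟩⟩
    refine ⟨{y}, Or.inl ⟨y, rfl⟩, fun a ha => ⟨fun h => Set.mem_singleton_iff.1 h ▸ hxy, fun h => ?_⟩⟩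
    rw [← hall, Finset.mem_filter] at ha
    exact (hD.eq_of_adj a ha.2 x hD.notMem h.symm).1

/-- A cut vertex without neighbours in its own tree is the only remaining one of its colour. -/
theorem eq_of_colour_eq (hL : IsLayout G T base c B) (hA : Conn G A) (hx : x ∈ A) (hcut : ¬ Conn G (A.erase x)) (hxB : x ∈ B)
    (hnt : ∀ y ∈ A, G.Adj x y → base y ≠ base x) {z : V} (hz : z ∈ A) (hzB : z ∈ B)
    (hc : c z = c x) : z = x := by
  by_contra hzx
  refine hcut (conn_erase_of_forall_adj hA hx (Finset.mem_erase.2 ⟨hzx, hz⟩) fun a ha hxa => ?_)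
  rw [hL.adj_iff_of_no_fibre_nbr hxB hnt a (Finset.mem_of_mem_erase ha)] at hxa
  exact hL.adj_of_colour z hzB a hxa.1 (hc ▸ hxa.2)

/-- If all neighbours of a cut vertex `x` have the same colour, then `x` is their only neighbour
outside their trees. -/
theorem eq_of_adj_colour (hL : IsLayout G T base c B) (hA : Conn G A) (hx : x ∈ A) (hcut : ¬ Conn G (A.erase x))
    (hnt : ∀ y ∈ A, G.Adj x y → base y ≠ base x) {j : ι}
    (hj : ∀ y ∈ A, G.Adj x y → c y = j) {z : V} (hz : z ∈ A) (hzB : z ∈ B)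
    (hc : T.Adj j (c z)) : z = x := by
  by_contra hzx
  refine hcut (conn_erase_of_forall_adj hA hx (Finset.mem_erase.2 ⟨hzx, hz⟩) fun a ha hxa => ?_)
  have ha := Finset.mem_of_mem_erase ha
  rcases hL.adj_cases x a hxa with h' | h'
  · exact absurd h'.symm (hnt a ha hxa)
  · exact hL.adj_of_colour z hzB a h'.2.1 (by rw [hj a ha hxa]; exact hc.symm)

theorem eq_of_colour_side (hL : IsLayout G T base c B) {J : Set ι} {i j : ι} (hJ : IsSide T J j i) {a b : V} (ha : c a ∈ J)
    (hb : c b ∉ J) (hab : G.Adj a b) : a ∈ colourClass c B j ∧ b ∈ colourClass c B i := by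
  rcases hL.adj_cases a b hab with h | ⟨haB, hbB, h⟩
  · exact absurd (hL.colour_eq a b h ▸ ha) hb
  · obtain ⟨h1, h2⟩ := hJ.eq_of_adj _ ha _ hb h
    exact ⟨⟨haB, h1⟩, hbB, h2⟩

theorem join_of_cut (hL : IsLayout G T base c B) (hT : T.IsTree) (hA : Conn G A) (hx : x ∈ A) (hcut : ¬ Conn G (A.erase x)) :
    ∃ S ∈ rootFamily T c B, (∃ A₁ A₂, A₁ ∪ A₂ = A ∧ IsJoin G {x} S A₁ A₂) ∧
      (A.filter (· ∈ S)).card < (A.filter (G.Adj x ·)).card := by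
  obtain ⟨p, hp, q, hq, hxp, hxq, hpq⟩ := exists_two_adj_of_cut hA hx hcut
  have hone : ∀ y, (A.filter (· ∈ ({y} : Set V))).card < (A.filter (G.Adj x ·)).card := by
    intro y
    have h1 : (A.filter (· ∈ ({y} : Set V))).card ≤ 1 :=
      Finset.card_le_one.2 fun a ha b hb =>
        (Finset.mem_filter.1 ha).2.trans (Finset.mem_filter.1 hb).2.symm
    have h2 : 1 < (A.filter (G.Adj x ·)).card :=
      Finset.one_lt_card.2 ⟨p, Finset.mem_filter.2 ⟨hp, hxp⟩, q, Finset.mem_filter.2 ⟨hq, hxq⟩, hpq⟩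
    omega
  have hsplit : ∀ (D : Set V), A.filter (· ∉ D) ∪ A.filter (· ∈ D) = A := by
    intro D
    rw [Finset.union_comm]
    exact Finset.filter_union_filter_not_eq _ _
  have hdisj : ∀ (D : Set V), Disjoint (A.filter (· ∉ D)) (A.filter (· ∈ D)) := fun D =>
    (Finset.disjoint_filter_filter_not _ _ _).symm
  by_cases hnt : ∀ y ∈ A, G.Adj x y → base y ≠ base x
  swap
  · push Not at hnt
    obtain ⟨y, hy, hxy, hb⟩ := hnt
    obtain ⟨D, hD, -⟩ := hL.exists_side y x hxy.symm hb
    refine ⟨{y}, Or.inl ⟨y, rfl⟩, ⟨_, _, hsplit D, hdisj D, ?_, ?_, ?_, ?_, ?_⟩, hone y⟩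
    · rintro a ha rfl
      exact hD.notMem (Finset.mem_filter.1 ha).2
    · rintro a ha rfl
      exact (Finset.mem_filter.1 ha).2 hD.mem
    · exact ⟨x, Finset.mem_filter.2 ⟨hx, hD.notMem⟩, rfl⟩
    · exact ⟨y, Finset.mem_filter.2 ⟨hy, hD.mem⟩, rfl⟩
    · intro a ha b hb
      constructor
      · intro hab
        exact (hD.eq_of_adj b (Finset.mem_filter.1 hb).2 a (Finset.mem_filter.1 ha).2 hab.symm).symm
      · rintro ⟨rfl, rfl⟩
        exact hxy
  have hxB : x ∈ B := by
    rcases hL.adj_cases x p hxp with h' | h'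
    · exact absurd h'.symm (hnt p hp hxp)
    · exact h'.1
  have hadj := hL.adj_iff_of_no_fibre_nbr hxB hnt
  have hTp := (hadj p hp).1 hxp
  by_cases hcol : ∀ y ∈ A, G.Adj x y → c y = c p
  -- By `eq_of_adj_colour`, the tree containing `p` is attached to the rest of `A` only by the edge
  -- `x p`.
  · refine ⟨{p}, Or.inl ⟨p, rfl⟩, ⟨_, _, hsplit {a | base a = base p}, hdisj _, ?_, ?_, ?_, ?_, ?_⟩,
      hone p⟩
    · rintro a ha rfl
      exact hnt p hp hxp (Finset.mem_filter.1 ha).2.symm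
    · rintro a ha rfl
      exact (Finset.mem_filter.1 ha).2 rfl
    · exact ⟨x, Finset.mem_filter.2 ⟨hx, fun h => hnt p hp hxp h.symm⟩, rfl⟩
    · exact ⟨p, Finset.mem_filter.2 ⟨hp, rfl⟩, rfl⟩
    · intro a ha b hb
      rw [Finset.mem_filter] at ha hb
      constructor
      · intro hab
        rcases hL.adj_cases a b hab with h | ⟨haB, hbB, h⟩
        · exact absurd (h.trans hb.2) ha.2
        · rw [hL.colour_eq b p hb.2] at h
          exact ⟨hL.eq_of_adj_colour hA hx hcut hnt hcol ha.1 haB h.symm,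
            hL.eq_of_mem b hbB p hTp.1 hb.2⟩
      · rintro ⟨rfl, rfl⟩
        exact hxp
  · push Not at hcol
    obtain ⟨y, hy, hxy, hyp⟩ := hcol
    obtain ⟨J, hJ⟩ := exists_isSide hT.isAcyclic hTp.2.symm
    have hxJ : c x ∉ J := hJ.notMem
    -- Cut along the edge of `T` between the colours of `p` and `x`: by `eq_of_colour_eq` only `x`
    -- has its colour. The neighbour `y` of another colour makes the count strict.
    refine ⟨colourClass c B (c p), Or.inr (Or.inl ⟨_, rfl⟩),
      ⟨_, _, hsplit {a | c a ∈ J}, hdisj _, ?_, ?_, ?_, ?_, ?_⟩, ?_⟩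
    · rintro a ha rfl
      exact hxJ (Finset.mem_filter.1 ha).2
    · rintro a ha ⟨-, hap⟩
      refine (Finset.mem_filter.1 ha).2 ?_
      rw [Set.mem_ofPred_eq, hap]
      exact hJ.mem
    · exact ⟨x, Finset.mem_filter.2 ⟨hx, hxJ⟩, rfl⟩
    · exact ⟨p, Finset.mem_filter.2 ⟨hp, hJ.mem⟩, hTp.1, rfl⟩
    · intro a ha b hb
      rw [Finset.mem_filter] at ha hb
      constructor
      · intro hab
        obtain ⟨h1, h2⟩ := hL.eq_of_colour_side hJ hb.2 ha.2 hab.symm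
        exact ⟨hL.eq_of_colour_eq hA hx hcut hxB hnt ha.1 h2.1 h2.2, h1⟩
      · rintro ⟨rfl, hbB, hbp⟩
        exact (hadj b hb.1).2 ⟨hbB, hbp ▸ hTp.2⟩
    · apply Finset.card_lt_card
      refine ⟨fun a ha => ?_, fun h => ?_⟩
      · rw [Finset.mem_filter] at ha ⊢
        exact ⟨ha.1, (hadj a ha.1).2 ⟨ha.2.1, ha.2.2 ▸ hTp.2⟩⟩
      · exact hyp (Finset.mem_filter.1 (h (Finset.mem_filter.2 ⟨hy, hxy⟩))).2.2

/-- Every component of `A - x` needs a root, and roots lie in the blow-up. This forces `x` to be in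
the blow-up without neighbours in its own tree. Unless `S` is centred at the colour of `x`, its
centre lies in the branch of every neighbour of `x`, so these share one colour and `A - x` has only
that colour. -/
theorem trace_of_cut (hL : IsLayout G T base c B) (hT : T.IsTree) (hG : G.Preconnected) (hA : Conn G A)
    (hS : S ∈ rootFamily T c B) (hx : x ∈ A) (hcut : ¬ Conn G (A.erase x))
    (hR : Rooted G S (A.erase x)) : ∀ a ∈ A.erase x, a ∈ S ↔ G.Adj x a := by
  have hSB : S ⊆ B := subset_of_mem_rootFamily hS fun v hv => hcut (hv ▸ hR).conn
  obtain ⟨p, hp, q, hq, hxp, hxq, hpq⟩ := exists_two_adj_of_cut hA hx hcut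
  have hfib : ∀ y ∈ A, G.Adj x y → base y = base x →
      ∃ D, IsSide G D y x ∧ ∃ r ∈ D, r ∈ B ∧ base r = base x := by
    intro y hy hxy hb
    obtain ⟨D, hD, h⟩ := hL.exists_side y x hxy.symm hb
    refine ⟨D, hD, h.resolve_left fun hDB => ?_⟩
    obtain ⟨s, hs, hsS⟩ := hR _ hD.closedIn
      ⟨y, Finset.mem_filter.2 ⟨Finset.mem_erase.2 ⟨hxy.ne', hy⟩, hD.mem⟩⟩
    exact hDB s (Finset.mem_filter.1 hs).2 (hSB hsS)
  have hxB : x ∈ B := by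
    by_contra hxB
    have hb : ∀ y, G.Adj x y → base y = base x := fun y hxy =>
      ((hL.adj_cases x y hxy).resolve_right fun h => hxB h.1).symm
    obtain ⟨D, hD, r, hrD, hr, hrx⟩ := hfib p hp hxp (hb p hxp)
    obtain ⟨D', hD', r', hrD', hr', hrx'⟩ := hfib q hq hxq (hb q hxq)
    obtain rfl := hL.eq_of_mem r hr r' hr' (hrx.trans hrx'.symm)
    exact Set.disjoint_left.1 (hD.disjoint hG hD' hxp.symm hxq.symm hpq) hrD hrD'
  have hnt : ∀ y ∈ A, G.Adj x y → base y ≠ base x := by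
    intro y hy hxy hb
    obtain ⟨D, hD, r, hrD, hr, hrx⟩ := hfib y hy hxy hb
    exact hD.notMem (hL.eq_of_mem r hr x hxB hrx ▸ hrD)
  have hadj := hL.adj_iff_of_no_fibre_nbr hxB hnt
  have huniq := fun z hz hzB => hL.eq_of_colour_eq hA hx hcut hxB hnt (z := z) hz hzB
  have hTp := (hadj p hp).1 hxp
  have hbranch : ∀ y ∈ A, G.Adj x y → ∀ J, IsSide T J (c y) (c x) →
      ∃ s ∈ A.erase x, s ∈ S ∧ c s ∈ J := by
    intro y hy hxy J hJ
    obtain ⟨s, hs, hsS⟩ := hR ((A.erase x).filter (c · ∈ J))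
      ⟨Finset.filter_subset _ _, fun a ha b hb hab => by
        rw [Finset.mem_filter] at ha ⊢
        refine ⟨hb, ?_⟩
        by_contra hbJ
        have h := (hL.eq_of_colour_side hJ ha.2 hbJ hab).2
        rw [Finset.mem_erase] at hb
        exact hb.1 (huniq b hb.2 h.1 h.2)⟩
      ⟨y, Finset.mem_filter.2 ⟨Finset.mem_erase.2 ⟨hxy.ne', hy⟩, hJ.mem⟩⟩
    rw [Finset.mem_filter] at hs
    exact ⟨s, hs.1, hsS, hs.2⟩
  by_cases hSx : S = colourNbhd T c B (c x)
  · intro a ha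
    rw [hSx, hadj a (Finset.mem_of_mem_erase ha)]
    rfl
  -- the centre of `S` lies in the branch of each neighbour of `x`
  obtain ⟨k, hk⟩ : ∃ k, ∀ y ∈ A, G.Adj x y → ∀ J, IsSide T J (c y) (c x) → k ∈ J := by
    rcases hS with ⟨v, rfl⟩ | ⟨k, rfl⟩ | ⟨k, rfl⟩
    · exact absurd hR.conn hcut
    · refine ⟨k, fun y hy hxy J hJ => ?_⟩
      obtain ⟨s, -, hsS, hsJ⟩ := hbranch y hy hxy J hJ
      exact hsS.2 ▸ hsJ
    · refine ⟨k, fun y hy hxy J hJ => ?_⟩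
      obtain ⟨s, -, hsS, hsJ⟩ := hbranch y hy hxy J hJ
      by_contra hkJ
      exact hSx (by rw [(hJ.eq_of_adj _ hsJ _ hkJ hsS.2.symm).2])
  have hcol : ∀ y ∈ A, G.Adj x y → c y = c p := by
    intro y hy hxy
    by_contra hyp
    have hTy := ((hadj y hy).1 hxy).2
    obtain ⟨J, hJ⟩ := exists_isSide hT.isAcyclic hTp.2.symm
    obtain ⟨J', hJ'⟩ := exists_isSide hT.isAcyclic hTy.symm
    exact Set.disjoint_left.1
      (hJ'.disjoint hT.connected.preconnected hJ hTy.symm hTp.2.symm hyp)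
      (hk y hy hxy J' hJ') (hk p hp hxp J hJ)
  have hall : ∀ a ∈ A.erase x, c a = c p := by
    have : insert x (A.filter (c · = c p)) = A := by
      refine hA _ ⟨Finset.insert_subset hx (Finset.filter_subset _ _), fun a ha b hb hab => ?_⟩
        ⟨x, Finset.mem_insert_self _ _⟩
      rw [Finset.mem_insert, Finset.mem_filter] at ha ⊢
      rcases ha with rfl | ⟨-, ha⟩
      · exact Or.inr ⟨hb, hcol b hb hab⟩
      · rcases hL.adj_cases a b hab with h | ⟨-, hbB, h⟩
        · exact Or.inr ⟨hb, (hL.colour_eq a b h).symm.trans ha⟩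
        · exact Or.inl (hL.eq_of_adj_colour hA hx hcut hnt hcol hb hbB (ha ▸ h))
    intro a ha
    rw [Finset.mem_erase, ← this, Finset.mem_insert, Finset.mem_filter] at ha
    exact (ha.2.resolve_left ha.1).2
  obtain ⟨s, hs, hsS⟩ := hR _ ⟨subset_rfl, fun _ _ _ hy _ => hy⟩
    ⟨p, Finset.mem_erase.2 ⟨hxp.ne', hp⟩⟩
  intro a ha
  have hca := hall a ha
  rw [hadj a (Finset.mem_of_mem_erase ha), hca]
  refine Iff.trans ⟨fun h => hSB h, fun haB => ?_⟩ (iff_self_and.2 fun _ => hTp.2)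
  have hcs : c a = c s := hca.trans (hall s hs).symm
  rcases hS with ⟨v, rfl⟩ | ⟨k, rfl⟩ | ⟨k, rfl⟩
  · exact absurd hR.conn hcut
  · exact ⟨haB, hcs.trans hsS.2⟩
  · exact ⟨haB, hcs ▸ hsS.2⟩

theorem isJoin_colour (hL : IsLayout G T base c B) {k : ι} (hA : Conn G A) {a b : V} (ha : a ∈ A) (hb : b ∈ A)
    (haS : a ∈ colourClass c B k) (hbB : b ∈ B) (hab : a ≠ b) :
    IsJoin G (colourClass c B k) (colourNbhd T c B k)
      (A.filter (c · = k)) (A.filter (c · ≠ k)) := by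
  have hadj : ∀ u ∈ A.filter (c · = k), ∀ v ∈ A.filter (c · ≠ k),
      G.Adj u v ↔ u ∈ colourClass c B k ∧ v ∈ colourNbhd T c B k := by
    intro u hu v hv
    rw [Finset.mem_filter] at hu hv
    constructor
    · intro huv
      rcases hL.adj_cases u v huv with h | ⟨huB, hvB, h⟩
      · exact absurd ((hL.colour_eq u v h).symm.trans hu.2) hv.2
      · exact ⟨⟨huB, hu.2⟩, hvB, hu.2 ▸ h⟩
    · rintro ⟨⟨huB, rfl⟩, hvB, h⟩
      exact hL.adj_of_colour u huB v hvB h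
  refine ⟨Finset.disjoint_filter_filter_not _ _ _, ?_, ?_, ⟨a, Finset.mem_filter.2 ⟨ha, haS.2⟩, haS⟩,
    ?_, hadj⟩
  · exact fun u hu h => (Finset.mem_filter.1 hu).2 h.2
  · exact fun u hu h => h.2.ne (Finset.mem_filter.1 hu).2.symm
  · by_contra! hcon
    -- Without a neighbouring colour, `A` would lie in the attached tree of `a`, which has just one
    -- blow-up vertex.
    have h1 : A.filter (base · = base a) = A := by
      refine hA _ ⟨Finset.filter_subset _ _, fun u hu v hv huv => ?_⟩ ⟨a, by simp [ha]⟩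
      rw [Finset.mem_filter] at hu ⊢
      refine ⟨hv, ?_⟩
      rcases hL.adj_cases u v huv with h | ⟨-, hvB, h⟩
      · exact h ▸ hu.2
      · rw [hL.colour_eq u a hu.2, haS.2] at h
        exact absurd ⟨hvB, h⟩ (hcon v (Finset.mem_filter.2 ⟨hv, h.ne'⟩))
    rw [← h1, Finset.mem_filter] at hb
    exact hab (hL.eq_of_mem a haS.1 b hbB hb.2.symm)

theorem exists_join (hL : IsLayout G T base c B) (hT : T.IsTree) (hA : Conn G A) (hS : S ∈ rootFamily T c B)
    (h : ∃ a ∈ A, ∃ b ∈ A, a ∈ S ∧ b ∈ S ∧ a ≠ b) :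
    ∃ S₂ ∈ rootFamily T c B, ∃ A₁ A₂, A₁ ∪ A₂ = A ∧ IsJoin G S S₂ A₁ A₂ := by
  obtain ⟨a, ha, b, hb, haS, hbS, hab⟩ := h
  have hsplit : ∀ k, A.filter (c · = k) ∪ A.filter (c · ≠ k) = A := fun k =>
    Finset.filter_union_filter_not_eq _ _
  rcases hS with ⟨v, rfl⟩ | ⟨k, rfl⟩ | ⟨k, rfl⟩
  · exact absurd (haS.trans hbS.symm) hab
  · exact ⟨_, Or.inr (Or.inr ⟨k, rfl⟩), _, _, hsplit k, hL.isJoin_colour hA ha hb haS hbS.1 hab⟩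
  by_cases hk : ∃ z ∈ A, z ∈ colourClass c B k
  · obtain ⟨z, hz, hzS⟩ := hk
    refine ⟨_, Or.inr (Or.inl ⟨k, rfl⟩), _, _, (Finset.union_comm _ _).trans (hsplit k),
      (hL.isJoin_colour hA hz ha hzS haS.1 ?_).symm⟩
    rintro rfl
    exact haS.2.ne hzS.2.symm
  push Not at hk
  obtain ⟨J, hJ⟩ := exists_isSide hT.isAcyclic haS.2.symm
  -- With no blow-up vertex of colour `k` left, `A` cannot cross the edge of `T` from `c a` to `k`;
  -- so all roots have colour `c a` and form the trace of a colour class.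
  have hAJ : A.filter (c · ∈ J) = A := by
    refine hA _ ⟨Finset.filter_subset _ _, fun u hu v hv huv => ?_⟩
      ⟨a, Finset.mem_filter.2 ⟨ha, hJ.mem⟩⟩
    rw [Finset.mem_filter] at hu ⊢
    refine ⟨hv, ?_⟩
    by_contra hvJ
    exact hk v hv (hL.eq_of_colour_side hJ hu.2 hvJ huv).2
  have htr : ∀ u ∈ A, u ∈ colourNbhd T c B k ↔ u ∈ colourClass c B (c a) := by
    intro u hu
    refine ⟨fun h => ⟨h.1, ?_⟩, fun h => ⟨h.1, h.2 ▸ haS.2⟩⟩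
    have huJ := hu
    rw [← hAJ, Finset.mem_filter] at huJ
    exact (hJ.eq_of_adj _ huJ.2 k hJ.notMem h.2.symm).1
  have hj := hL.isJoin_colour hA ha hb ⟨haS.1, rfl⟩ hbS.1 hab
  refine ⟨_, Or.inr (Or.inr ⟨c a, rfl⟩), _, _, hsplit (c a), hj.disjoint, fun u hu => ?_,
    hj.notMem_right, ?_, hj.nonempty_right, fun u hu v hv => ?_⟩
  · rw [htr u (Finset.mem_filter.1 hu).1]
    exact hj.notMem_left u hu
  · exact ⟨a, by simp [ha], haS⟩
  · rw [htr u (Finset.mem_filter.1 hu).1]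
    exact hj.adj_iff u hu v hv

theorem isRootFamily (hL : IsLayout G T base c B) (hT : T.IsTree) (hG : G.Preconnected) :
    IsRootFamily G (rootFamily T c B) where
  singleton_mem v := Or.inl ⟨v, rfl⟩
  trace_of_cut hA hS hx hcut hR := hL.trace_of_cut hT hG hA hS hx hcut hR
  join_of_cut hA hx hcut := hL.join_of_cut hT hA hx hcut
  trace_of_conn hcx := hL.trace_of_conn hcx
  join hA hS h := hL.exists_join hT hA hS h

end IsLayout

theorem isLayout {H : SimpleGraph W} {part : W → ι} {incl : W → V} (hH : IsBlowUp T H part)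
    (hG : IsGraphTree H G incl base) :
    IsLayout G T base (fun v => part (base v)) {v | v = incl (base v)} where
  colour_eq u v h := congrArg part h
  adj_cases u v h := by
    by_cases hb : base u = base v
    · exact Or.inl hb
    · obtain ⟨h1, h2, h3⟩ := (hG.adj_iff u v hb).1 h
      exact Or.inr ⟨h2, h3, (hH.adj_iff _ _).1 h1⟩
  adj_of_colour u hu v hv h := (hG.adj_iff u v fun hb => h.ne (congrArg part hb)).2
    ⟨(hH.adj_iff _ _).2 h, hu, hv⟩
  eq_of_mem u hu v hv h := by
    rw [Set.mem_ofPred_eq] at hu hv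
    rw [hu, hv, h]
  exists_side y x hyx hb := by
    obtain ⟨D, hD⟩ := exists_isSide (G := G.induce {v | base v = base x}) (y := ⟨y, hb⟩)
      (x := ⟨x, rfl⟩) (hG.isTree _).isAcyclic hyx
    have hr : base (incl (base x)) = base x := hG.base_incl _
    -- The side inside the attached tree, together with all other trees if it contains the attaching
    -- vertex.
    refine ⟨{a | (∃ h : base a = base x, ⟨a, h⟩ ∈ D) ∨
      base a ≠ base x ∧ (⟨incl (base x), hr⟩ : {v | base v = base x}) ∈ D},
      ⟨Or.inl ⟨hb, hD.mem⟩, ?_, ?_⟩, ?_⟩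
    · rintro (⟨_, h⟩ | h)
      · exact hD.notMem h
      · exact h.1 rfl
    · intro a ha b hbD hab
      rw [Set.mem_ofPred_eq] at ha hbD
      push Not at hbD
      by_cases hax : base a = base x
      · have haD : ⟨a, hax⟩ ∈ D := ha.elim (fun h => h.2) fun h => absurd hax h.1
        by_cases hbx : base b = base x
        · have := hD.eq_of_adj ⟨a, hax⟩ haD ⟨b, hbx⟩ (hbD.1 hbx) hab
          simpa using this
        · have := ((hG.adj_iff a b (by rw [hax]; exact Ne.symm hbx)).1 hab).2.1
          refine absurd ?_ (hbD.2 hbx)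
          have he : a = incl (base x) := by rw [this, hax]
          subst he
          exact haD
      · have hrD := ha.elim (fun h => absurd h.1 hax) fun h => h.2
        by_cases hbx : base b = base x
        · have := ((hG.adj_iff a b (by rw [hbx]; exact hax)).1 hab).2.2
          refine absurd hrD ?_
          have he : b = incl (base x) := by rw [this, hbx]
          subst he
          exact hbD.1 hbx
        · exact absurd hrD (hbD.2 hbx)
    · by_cases hrD : (⟨incl (base x), hr⟩ : {v | base v = base x}) ∈ D
      · exact Or.inr ⟨incl (base x), Or.inl ⟨hr, hrD⟩, by rw [Set.mem_ofPred_eq, hr], hr⟩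
      · refine Or.inl ?_
        rintro a (⟨h, haD⟩ | h) haB
        · rw [Set.mem_ofPred_eq, h] at haB
          subst haB
          exact hrD haD
        · exact hrD h.2

end Sides

/-! ### Translation back to the scores of the players -/

section Scores

open scoped Classical

variable {V : Type*} {G : SimpleGraph V} {w : V → ℝ} {S : Set V}

theorem preconnected_induce_iff_conn (A : Finset V) :
    (G.induce {u | u ∈ A}).Preconnected ↔ Conn G A := by
  constructor
  · rintro h C hC ⟨a, ha⟩
    refine hC.1.antisymm fun b hb => ?_
    exact mem_of_reachable (G := G.induce {u | u ∈ A}) (E := {u | (u : V) ∈ C})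
      (fun u hu v huv => hC.2 u hu v v.2 huv) (h ⟨a, hC.1 ha⟩ ⟨b, hb⟩) ha
  · rintro h ⟨a, ha⟩ ⟨b, hb⟩
    have := h (A.filter fun v => ∃ hv : v ∈ A, (G.induce {u | u ∈ A}).Reachable ⟨a, ha⟩ ⟨v, hv⟩)
      ⟨Finset.filter_subset _ _, fun u hu v hv huv => by
        obtain ⟨huA, hu', hr⟩ := Finset.mem_filter.1 hu
        refine Finset.mem_filter.2 ⟨hv, hv, hr.trans (SimpleGraph.Adj.reachable ?_)⟩
        exact huv⟩
      ⟨a, Finset.mem_filter.2 ⟨ha, ha, .refl _⟩⟩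
    have hb' : b ∈ A := hb
    rw [← this, Finset.mem_filter] at hb'
    exact hb'.2.2

theorem isRootSet_induce_iff_rooted (A : Finset V) :
    IsRootSet (G.induce {u | u ∈ A}) {u | (u : V) ∈ S} ↔ Rooted G S A := by
  constructor
  · rintro h C hC ⟨a, ha⟩
    obtain ⟨s, hsS, hs⟩ := h ((G.induce {u | u ∈ A}).connectedComponentMk ⟨a, hC.1 ha⟩)
    refine ⟨s, ?_, hsS⟩
    rw [SimpleGraph.ConnectedComponent.mem_supp_iff, SimpleGraph.ConnectedComponent.eq] at hs
    exact mem_of_reachable (G := G.induce {u | u ∈ A}) (E := {u | (u : V) ∈ C})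
      (fun u hu v huv => hC.2 u hu v v.2 huv) hs.symm ha
  · intro h K
    induction K using SimpleGraph.ConnectedComponent.ind with
    | h a =>
    obtain ⟨a, ha⟩ := a
    obtain ⟨s, hs, hsS⟩ := h (A.filter fun v => ∃ hv : v ∈ A,
        (G.induce {u | u ∈ A}).Reachable ⟨a, ha⟩ ⟨v, hv⟩)
      ⟨Finset.filter_subset _ _, fun u hu v hv huv => by
        obtain ⟨huA, hu', hr⟩ := Finset.mem_filter.1 hu
        refine Finset.mem_filter.2 ⟨hv, hv, hr.trans (SimpleGraph.Adj.reachable ?_)⟩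
        exact huv⟩
      ⟨a, Finset.mem_filter.2 ⟨ha, ha, .refl _⟩⟩
    obtain ⟨-, hsA, hr⟩ := Finset.mem_filter.1 hs
    refine ⟨⟨s, hsA⟩, hsS, ?_⟩
    rw [SimpleGraph.ConnectedComponent.mem_supp_iff, SimpleGraph.ConnectedComponent.eq]
    exact hr.symm

theorem moves_eq_movesOf (G : SimpleGraph V) : moves G = movesOf (Conn G) := by
  ext A v
  simp only [moves, movesOf, Finset.mem_filter, preconnected_induce_iff_conn]

theorem rootedMoves_eq_movesOf (G : SimpleGraph V) (S : Set V) :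
    rootedMoves G S = movesOf (Rooted G S) := by
  ext A v
  simp only [rootedMoves, movesOf, Finset.mem_filter, isRootSet_induce_iff_rooted]

theorem conn_univ [Fintype V] (hG : G.Preconnected) : Conn G Finset.univ := by
  rintro C hC ⟨a, ha⟩
  refine Finset.eq_univ_of_forall fun b => ?_
  exact mem_of_reachable (E := {u | u ∈ C}) (fun u hu v huv => hC.2 u hu v (Finset.mem_univ v) huv)
    (hG a b) ha

theorem IsRootFamily.scores_le [Fintype V] {F : Set (Set V)} (hF : IsRootFamily G F)
    (hG : G.Preconnected) (hS : S ∈ F) (hne : S.Nonempty) :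
    R G w S .secondLast ≤ N G w .secondLast ∧ N G w .last ≤ R G w S .last := by
  obtain ⟨s, hs⟩ := hne
  have hA := conn_univ hG
  have h := hF.gap_le (w := w) _ _ Finset.univ S rfl rfl hA hS ⟨s, Finset.mem_univ s, hs⟩
  have h1 := optimalScores_add (w := w) (accessible_conn G) _ Finset.univ rfl hA
  have h2 := optimalScores_add (w := w) (accessible_rooted G S) _ Finset.univ rfl
    (hA.rooted (Finset.mem_univ s) hs)
  simp only [R, N, Player.score, moves_eq_movesOf, rootedMoves_eq_movesOf, gap,
    Finset.card_univ] at h h1 h2 ⊢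
  split_ifs with ho
  · have := h.2 ho
    constructor <;> linarith
  · have := h.1 (Nat.not_odd_iff_even.1 ho)
    constructor <;> linarith

end Scores

end GraphGrabbing

theorem lemma3 {ι W V : Type*} [Fintype V]
    (T : SimpleGraph ι) (hT : T.IsTree)
    (H : SimpleGraph W) (part : W → ι) (hH : GraphGrabbing.IsBlowUp T H part)
    (G : SimpleGraph V) (incl : W → V) (base : V → W)
    (hG : GraphGrabbing.IsGraphTree H G incl base) (hconn : G.Connected)
    (w : V → ℝ) (hw : ∀ v, 0 ≤ w v) :
    (∀ v : V,
      GraphGrabbing.R G w {v} .secondLast ≤ GraphGrabbing.N G w .secondLast ∧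
      GraphGrabbing.N G w .last ≤ GraphGrabbing.R G w {v} .last) ∧
    (∀ i : ι,
      GraphGrabbing.R G w (incl '' {x | part x = i}) .secondLast
        ≤ GraphGrabbing.N G w .secondLast ∧
      GraphGrabbing.N G w .last
        ≤ GraphGrabbing.R G w (incl '' {x | part x = i}) .last) ∧
    (∀ i : ι, (GraphGrabbing.nbhd H {x | part x = i}).Nonempty →
      GraphGrabbing.R G w (incl '' GraphGrabbing.nbhd H {x | part x = i}) .secondLast
        ≤ GraphGrabbing.N G w .secondLast ∧
      GraphGrabbing.N G w .last
        ≤ GraphGrabbing.R G w (incl '' GraphGrabbing.nbhd H {x | part x = i}) .last) := by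
  have hF := (GraphGrabbing.isLayout hH hG).isRootFamily hT hconn.preconnected
  have himage : ∀ Q : W → Prop,
      incl '' {x | Q x} = {v | v ∈ {v | v = incl (base v)} ∧ Q (base v)} := by
    intro Q
    ext v
    constructor
    · rintro ⟨x, hx, rfl⟩
      rw [Set.mem_ofPred_eq, Set.mem_ofPred_eq, hG.base_incl]
      exact ⟨rfl, hx⟩
    · rintro ⟨h, hQ⟩
      exact ⟨base v, hQ, h.symm⟩
  refine ⟨fun v => hF.scores_le hconn.preconnected (hF.singleton_mem v) ⟨v, rfl⟩, fun i => ?_,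
    fun i hi => ?_⟩
  · obtain ⟨x, hx⟩ := hH.nonempty i
    refine hF.scores_le hconn.preconnected (Or.inr (Or.inl ⟨i, ?_⟩)) ⟨incl x, x, hx, rfl⟩
    exact himage fun x => part x = i
  · refine hF.scores_le hconn.preconnected (Or.inr (Or.inr ⟨i, ?_⟩)) (hi.image incl)
    have hn : GraphGrabbing.nbhd H {x | part x = i} = {y | T.Adj i (part y)} := by
      ext y
      constructor
      · rintro ⟨x, rfl, hxy⟩
        exact (hH.adj_iff x y).1 hxy
      · intro h
        obtain ⟨x, rfl⟩ := hH.nonempty i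
        exact ⟨x, rfl, (hH.adj_iff x y).2 h⟩
    rw [hn]
    exact himage fun y => T.Adj i (part y)
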